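/- Write $N=(0,1)$, $NE=(1,1)$, $E=(1,0)$, $SE=(1,-1)$, $S=(0,-1)$, $SW=(-1,-1)$, $W=(-1,0)$, $NW=(-1,1)$. For a set $\mathfrak S$ of such steps and $n\ge 0$ let $q_{\mathfrak S}(n)$ be the number of sequences $(v_1,\dots,v_n)\in\mathfrak S^n$ such that all the points $p_k=v_1+\dots+v_k$, $0\le k\le n$ (so $p_0=(0,0)$), lie in the quarter plane $\{(x,y)\in\mathbb Z^2 : x\ge 0,\ y\ge 0\}$. Consider the following 23 step sets $\mathfrak S_i$ (the quarter-plane models with small steps and finite group) and numbers $\beta_i$: $$\begin{array}{c|l|c} i & \mathfrak S_i & \beta_i\\ \hline 1 & \{N,S,E,W\} & 4\\ 2 & \{NW,SW,NE,SE\} & 4\\ 3 & \{N,S,NE,NW,SW,SE\} & 6\\ 4 & \{N,S,NE,NW,SW,SE,E,W\} & 8\\ 5 & \{S,NE,NW\} & 3\\ 6 & \{S,NE,NW,E,W\} & 5\\ 7 & \{S,NE,NW,N\} & 4\\ 8 & \{S,NE,NW,N,E,W\} & 6\\ 9 & \{SW,SE,NE,NW,N\} & 5\\ 10 & \{SW,SE,NE,NW,N,E,W\}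 & 7\\ 11 & \{S,SW,SE,N\} & 2\sqrt3\\ 12 & \{S,SW,SE,N,E,W\} & 2(1+\sqrt3)\\ 13 & \{S,SW,SE,NW,NE\} & 2\sqrt6\\ 14 & \{S,SW,SE,NW,NE,E,W\} & 2(1+\sqrt6)\\ 15 & \{SW,SE,N\} & 2\sqrt2\\ 16 & \{SW,SE,N,E,W\} & 2(1+\sqrt2)\\ 17 & \{N,W,SE\} & 3\\ 18 & \{N,S,E,W,NW,SE\} & 6\\ 19 & \{S,W,NE\} & 3\\ 20 & \{N,E,SW\} & 3\\ 21 & \{N,S,E,W,NE,SW\} & 6\\ 22 & \{NW,SE,W,E\} & 4\\ 23 & \{NE,SW,W,E\} & 4 \end{array}$$ Then for every $i=1,\dots,23$ the exponential growth factor of the sequence $q_{\mathfrak S_i}(n)$ is $\beta_i$, that is, $$\limsup_{n\to\infty} q_{\mathfrak S_i}(n)^{1/n}=\beta_i,$$ and the upper limit is in fact a limit: $$\lim_{n\to\infty}\frac1n\log q_{\mathfrak S_i}(n)=\log\beta_i .$$ -/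

import Mathlib

open Filter Topology

namespace QuarterPlane

/-! ### Lattice walks in the quarter plane -/

/-- A walk of length `n` on the step set `S`, given by its sequence of steps `v`. -/
def IsWalkOn (S : Finset (ℤ × ℤ)) {n : ℕ} (v : Fin n → ℤ × ℤ) : Prop :=
  ∀ i, v i ∈ S

/-- The point `p k` reached from the origin by the first `k` steps of `v`. -/
def point {n : ℕ} (v : Fin n → ℤ × ℤ) (k : ℕ) : ℤ × ℤ :=
  ∑ i : Fin n with i.val < k, v i

/-- The walks of length `n` on `S`, started at the origin and ending anywhere, all of whose points
`p 0, …, p n` lie in the quarter plane `x ≥ 0`, `y ≥ 0` (boundary included). -/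
def quarterPlaneWalks (S : Finset (ℤ × ℤ)) (n : ℕ) : Set (Fin n → ℤ × ℤ) :=
  {v | IsWalkOn S v ∧ ∀ k ≤ n, 0 ≤ (point v k).1 ∧ 0 ≤ (point v k).2}

theorem quarterPlaneWalks_finite (S : Finset (ℤ × ℤ)) (n : ℕ) :
    (quarterPlaneWalks S n).Finite :=
  (Fintype.piFinset fun _ : Fin n => S).finite_toSet.subset fun v hv => by
    simpa [IsWalkOn, Fintype.mem_piFinset] using hv.1

/-- The number of quarter-plane walks of length `n` on `S`. The set counted is finite, by
`quarterPlaneWalks_finite`. -/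
noncomputable def walkCount (S : Finset (ℤ × ℤ)) (n : ℕ) : ℕ :=
  (quarterPlaneWalks S n).ncard

/-! ### Exponential growth -/

/-- The sequence `a` is of exponential order `K ^ n`: the limsup of `|a n| ^ (1 / n)` is `K`.
The limsup is taken in the extended reals, where it always exists. -/
def IsOfExponentialOrder (a : ℕ → ℝ) (K : ℝ) : Prop :=
  limsup (fun n : ℕ => ((|a n| ^ (1 / (n : ℝ)) : ℝ) : EReal)) atTop = (K : EReal)

/-! ### The 23 models -/

/-- The step north. -/
def N : ℤ × ℤ := (0, 1)
/-- The step north-east. -/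
def NE : ℤ × ℤ := (1, 1)
/-- The step east. -/
def E : ℤ × ℤ := (1, 0)
/-- The step south-east. -/
def SE : ℤ × ℤ := (1, -1)
/-- The step south. -/
def S : ℤ × ℤ := (0, -1)
/-- The step south-west. -/
def SW : ℤ × ℤ := (-1, -1)
/-- The step west. -/
def W : ℤ × ℤ := (-1, 0)
/-- The step north-west. -/
def NW : ℤ × ℤ := (-1, 1)

/-- The step sets of the 23 models with finite group, indexed by `1, …, 23` (the value at any other
index is not used). -/
def stepSet : ℕ → Finset (ℤ × ℤ)
  | 1 => {N, S, E, W}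
  | 2 => {NW, SW, NE, SE}
  | 3 => {N, S, NE, NW, SW, SE}
  | 4 => {N, S, NE, NW, SW, SE, E, W}
  | 5 => {S, NE, NW}
  | 6 => {S, NE, NW, E, W}
  | 7 => {S, NE, NW, N}
  | 8 => {S, NE, NW, N, E, W}
  | 9 => {SW, SE, NE, NW, N}
  | 10 => {SW, SE, NE, NW, N, E, W}
  | 11 => {S, SW, SE, N}
  | 12 => {S, SW, SE, N, E, W}
  | 13 => {S, SW, SE, NW, NE}
  | 14 => {S, SW, SE, NW, NE, E, W}
  | 15 => {SW, SE, N}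
  | 16 => {SW, SE, N, E, W}
  | 17 => {N, W, SE}
  | 18 => {N, S, E, W, NW, SE}
  | 19 => {S, W, NE}
  | 20 => {N, E, SW}
  | 21 => {N, S, E, W, NE, SW}
  | 22 => {NW, SE, W, E}
  | 23 => {NE, SW, W, E}
  | _ => ∅

/-- The exponential growth factors of the 23 models, indexed by `1, …, 23` (the value at any other
index is not used). -/
noncomputable def growthFactor : ℕ → ℝ
  | 1 => 4
  | 2 => 4
  | 3 => 6
  | 4 => 8
  | 5 => 3
  | 6 => 5
  | 7 => 4
  | 8 => 6
  | 9 => 5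
  | 10 => 7
  | 11 => 2 * √3
  | 12 => 2 * (1 + √3)
  | 13 => 2 * √6
  | 14 => 2 * (1 + √6)
  | 15 => 2 * √2
  | 16 => 2 * (1 + √2)
  | 17 => 3
  | 18 => 6
  | 19 => 3
  | 20 => 3
  | 21 => 6
  | 22 => 4
  | 23 => 4
  | _ => 0

end QuarterPlane

/-! Weight a step `s` by `y ^ s.2` with `y ≥ 1`, chosen so that the horizontal drift vanishes, the
vertical drift `d` is nonnegative, and `y = 1` or `d = 0`. The growth factor is the total weight
`β`.

Upper bound (`walksFrom_le`): `y ^ p.2` is an eigenfunction of the step operator for `β`, and is at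
least 1 on the quarter plane.

Lower bound: by Chebyshev (`le_freeSum_indicator`), at least `β ^ m² / (2 y ^ (2m))` free walks of
length `m²` end at or above `(-2m, -2m)`. Far from the axes these walks are admissible, and `O(m)`
further steps along the diagonal undo the loss (`freeSum_block_le`), so such blocks can be repeated
indefinitely. Their growth rate tends to `log β` as `m` grows. Concatenation of walks makes the
counts supermultiplicative, so Fekete's lemma provides the limit. -/

namespace QuarterPlane

/-! ### Counting by recursion on the first step -/

/-- The number of walks of length `n` on `S` from `p` whose points after the first one stay in
the quarter plane. -/
def walksFrom (S : Finset (ℤ × ℤ)) : ℕ → ℤ × ℤ → ℕ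
  | 0, _ => 1
  | n + 1, p => ∑ s ∈ S, if 0 ≤ p + s then walksFrom S n (p + s) else 0

/-- The walks of length `n` on `S` from `p` all of whose points lie in the quarter plane. -/
def walkSetFrom (S : Finset (ℤ × ℤ)) (p : ℤ × ℤ) (n : ℕ) : Set (Fin n → ℤ × ℤ) :=
  {v | IsWalkOn S v ∧ ∀ k ≤ n, 0 ≤ p + point v k}

theorem walkSetFrom_finite (S : Finset (ℤ × ℤ)) (p : ℤ × ℤ) (n : ℕ) :
    (walkSetFrom S p n).Finite :=
  (Fintype.piFinset fun _ : Fin n => S).finite_toSet.subset fun v hv => by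
    simpa [IsWalkOn, Fintype.mem_piFinset] using hv.1

@[simp]
theorem point_zero {n : ℕ} (v : Fin n → ℤ × ℤ) : point v 0 = 0 := by
  simp [point]

theorem point_cons_succ {n : ℕ} (s : ℤ × ℤ) (v : Fin n → ℤ × ℤ) (k : ℕ) :
    point (Fin.cons s v : Fin (n + 1) → ℤ × ℤ) (k + 1) = s + point v k := by
  simp [point, Finset.sum_filter, Fin.sum_univ_succ]

theorem cons_mem_walkSetFrom {S : Finset (ℤ × ℤ)} {p s : ℤ × ℤ} (hp : 0 ≤ p) {n : ℕ}
    {v : Fin n → ℤ × ℤ} :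
    (Fin.cons s v : Fin (n + 1) → ℤ × ℤ) ∈ walkSetFrom S p (n + 1) ↔
      s ∈ S ∧ v ∈ walkSetFrom S (p + s) n := by
  constructor
  · rintro ⟨h1, h2⟩
    refine ⟨by simpa using h1 0, fun i => by simpa using h1 i.succ, fun k hk => ?_⟩
    simpa [point_cons_succ, add_assoc] using h2 (k + 1) (by omega)
  · rintro ⟨hs, h1, h2⟩
    refine ⟨fun i => ?_, fun k hk => ?_⟩
    · induction i using Fin.cases with
      | zero => simpa using hs
      | succ i => simpa using h1 i
    · cases k with
      | zero => simpa using hp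
      | succ k => simpa [point_cons_succ, add_assoc] using h2 k (by omega)

theorem ncard_walkSetFrom (S : Finset (ℤ × ℤ)) (n : ℕ) :
    ∀ p : ℤ × ℤ, 0 ≤ p → (walkSetFrom S p n).ncard = walksFrom S n p := by
  induction n with
  | zero =>
    intro p hp
    have : walkSetFrom S p 0 = Set.univ := by
      ext v
      simp [walkSetFrom, IsWalkOn, hp]
    simp [this, walksFrom]
  | succ n ih =>
    intro p hp
    have hset : walkSetFrom S p (n + 1) =
        ⋃ s ∈ S, (fun v => (Fin.cons s v : Fin (n + 1) → ℤ × ℤ)) '' walkSetFrom S (p + s) n := by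
      ext v
      rw [← Fin.cons_self_tail v, cons_mem_walkSetFrom hp]
      simp only [Set.mem_iUnion, Set.mem_image, Fin.cons_inj, exists_prop]
      constructor
      · rintro ⟨h1, h2⟩
        exact ⟨_, h1, _, h2, rfl, rfl⟩
      · rintro ⟨s, h1, w, h2, rfl, rfl⟩
        exact ⟨h1, h2⟩
    have hdisj : (S : Set (ℤ × ℤ)).PairwiseDisjoint fun s =>
        (fun v => (Fin.cons s v : Fin (n + 1) → ℤ × ℤ)) '' walkSetFrom S (p + s) n := by
      intro s _ t _ hst
      refine Set.disjoint_left.2 ?_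
      rintro _ ⟨v, _, rfl⟩ ⟨w, _, h⟩
      exact hst (Fin.cons_inj.1 h).1.symm
    have hsum := S.finite_toSet.ncard_biUnion
      (fun s _ => (walkSetFrom_finite S (p + s) n).image _) hdisj
    rw [finsum_mem_coe_finset] at hsum
    rw [hset, walksFrom]
    refine hsum.trans ?_
    refine Finset.sum_congr rfl fun s _ => ?_
    have hinj : Function.Injective fun v => (Fin.cons s v : Fin (n + 1) → ℤ × ℤ) :=
      fun v w h => (Fin.cons_inj.1 h).2
    rw [Set.ncard_image_of_injective _ hinj]
    split_ifs with h
    · exact ih _ h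
    · have : walkSetFrom S (p + s) n = ∅ := by
        refine Set.eq_empty_of_forall_notMem fun v hv => h ?_
        simpa using hv.2 0 (Nat.zero_le n)
      simp [this]

theorem walkCount_eq_walksFrom (S : Finset (ℤ × ℤ)) (n : ℕ) :
    walkCount S n = walksFrom S n 0 := by
  rw [← ncard_walkSetFrom S n 0 le_rfl, walkCount]
  congr 1
  ext v
  simp [quarterPlaneWalks, walkSetFrom, Prod.le_def]

/-! ### Elementary properties of the counts -/

variable {S : Finset (ℤ × ℤ)}

/-- Translating a walk by `q - p ≥ 0` keeps it in the quarter plane. -/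
theorem walksFrom_mono (n : ℕ) : ∀ {p q : ℤ × ℤ}, p ≤ q → walksFrom S n p ≤ walksFrom S n q := by
  induction n with
  | zero => intros; simp [walksFrom]
  | succ n ih =>
    intro p q hpq
    refine Finset.sum_le_sum fun s _ => ?_
    have hs : p + s ≤ q + s := by gcongr
    split_ifs with h1 h2 h2
    · exact ih hs
    · exact absurd (h1.trans hs) h2
    · exact Nat.zero_le _
    · exact le_rfl

/-- The first part ends at a point `≥ 0`, which has at least as many continuations as the origin. -/
theorem walksFrom_mul_le (m n : ℕ) :
    ∀ {p : ℤ × ℤ}, 0 ≤ p → walksFrom S m p * walksFrom S n 0 ≤ walksFrom S (m + n) p := by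
  induction m with
  | zero => intro p hp; simpa [walksFrom] using walksFrom_mono n hp
  | succ m ih =>
    intro p hp
    rw [Nat.succ_add, walksFrom, walksFrom, Finset.sum_mul]
    refine Finset.sum_le_sum fun s _ => ?_
    split_ifs with h
    · exact ih h
    · simp

theorem walksFrom_add_step_le {s p : ℤ × ℤ} (hs : s ∈ S) (h : 0 ≤ p + s) (n : ℕ) :
    walksFrom S n (p + s) ≤ walksFrom S (n + 1) p := by
  rw [walksFrom]
  refine le_trans ?_ (Finset.single_le_sum (f := fun s => if 0 ≤ p + s then
    walksFrom S n (p + s) else 0) (fun _ _ => Nat.zero_le _) hs)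
  simp [h]

/-- From every point of the quarter plane, `l` steps suffice to move by `(1, 1)` without leaving
the quarter plane. -/
def HasDiagonalWord (S : Finset (ℤ × ℤ)) (l : ℕ) : Prop :=
  ∀ (n : ℕ) (p : ℤ × ℤ), 0 ≤ p → walksFrom S n (p + (1, 1)) ≤ walksFrom S (n + l) p

theorem hasDiagonalWord_one {a : ℤ × ℤ} (ha : a ∈ S) (h : a = (1, 1)) :
    HasDiagonalWord S 1 := by
  subst h
  intro n p hp
  exact walksFrom_add_step_le ha (add_nonneg hp (by decide)) n

theorem hasDiagonalWord_two {a b : ℤ × ℤ} (ha : a ∈ S) (hb : b ∈ S) (ha0 : 0 ≤ a)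
    (h : a + b = (1, 1)) : HasDiagonalWord S 2 := by
  intro n p hp
  have h2 : 0 ≤ p + a + b := by
    rw [add_assoc, h]; exact add_nonneg hp (by decide)
  rw [← h, ← add_assoc]
  exact (walksFrom_add_step_le hb h2 n).trans
    (walksFrom_add_step_le ha (add_nonneg hp ha0) (n + 1))

theorem hasDiagonalWord_three {a b : ℤ × ℤ} (ha : a ∈ S) (hb : b ∈ S) (ha0 : 0 ≤ a)
    (h : a + a + b = (1, 1)) : HasDiagonalWord S 3 := by
  intro n p hp
  have h2 : 0 ≤ p + a + a + b := by
    rw [add_assoc p, add_assoc p, h]; exact add_nonneg hp (by decide)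
  rw [← h, ← add_assoc, ← add_assoc]
  exact (walksFrom_add_step_le hb h2 n).trans
    ((walksFrom_add_step_le ha (add_nonneg (add_nonneg hp ha0) ha0) (n + 1)).trans
    (walksFrom_add_step_le ha (add_nonneg hp ha0) (n + 2)))

theorem HasDiagonalWord.iterate {l : ℕ} (h : HasDiagonalWord S l) (r n : ℕ) :
    ∀ {p : ℤ × ℤ}, 0 ≤ p → walksFrom S n (p + ((r : ℤ), (r : ℤ))) ≤ walksFrom S (n + l * r) p := by
  induction r with
  | zero => intro p hp; simp [← Prod.zero_eq_mk]
  | succ r ih =>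
    intro p hp
    have h1 := ih (p := p + (1, 1)) (add_nonneg hp (by decide))
    have h2 := h (n + l * r) p hp
    have e : p + (1, 1) + ((r : ℤ), (r : ℤ)) = p + (((r + 1 : ℕ) : ℤ), ((r + 1 : ℕ) : ℤ)) := by
      ext <;> push_cast <;> simp <;> ring
    rw [e] at h1
    rw [Nat.mul_succ, ← add_assoc]
    exact h1.trans h2

/-! ### Unconstrained walks -/

/-- The sum of `g` over the end points of all walks of length `n` on `S` from `p`. -/
def freeSum (S : Finset (ℤ × ℤ)) (g : ℤ × ℤ → ℝ) : ℕ → ℤ × ℤ → ℝ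
  | 0, p => g p
  | n + 1, p => ∑ s ∈ S, freeSum S g n (p + s)

theorem freeSum_mono {g h : ℤ × ℤ → ℝ} (hgh : ∀ p, g p ≤ h p) (n : ℕ) :
    ∀ p, freeSum S g n p ≤ freeSum S h n p := by
  induction n with
  | zero => exact hgh
  | succ n ih => exact fun p => Finset.sum_le_sum fun s _ => ih _

theorem freeSum_const_mul (c : ℝ) (g : ℤ × ℤ → ℝ) (n : ℕ) :
    ∀ p, freeSum S (fun q => c * g q) n p = c * freeSum S g n p := by
  induction n with
  | zero => exact fun p => rfl
  | succ n ih => intro p; simp only [freeSum, ih, Finset.mul_sum]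

theorem freeSum_add_right (g : ℤ × ℤ → ℝ) (a : ℤ × ℤ) (n : ℕ) :
    ∀ p, freeSum S (fun q => g (q - a)) n (p + a) = freeSum S g n p := by
  induction n with
  | zero => intro p; simp [freeSum]
  | succ n ih =>
    intro p
    simp only [freeSum]
    exact Finset.sum_congr rfl fun s _ => by rw [← ih, add_right_comm]

/-- All steps of `S` are small. -/
def SmallSteps (S : Finset (ℤ × ℤ)) : Prop :=
  ∀ s ∈ S, |s.1| ≤ 1 ∧ |s.2| ≤ 1

/-- A walk of length `m` started at distance `m` from the axes does not leave the quarter plane. -/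
theorem freeSum_le_walksFrom (hS : SmallSteps S) (n m : ℕ) :
    ∀ p : ℤ × ℤ, ((m : ℤ), (m : ℤ)) ≤ p →
      freeSum S (fun q => if 0 ≤ q then (walksFrom S n q : ℝ) else 0) m p ≤
        walksFrom S (n + m) p := by
  induction m with
  | zero =>
    intro p _
    simp only [freeSum]
    split_ifs <;> simp
  | succ m ih =>
    intro p hp
    rw [← add_assoc, walksFrom, freeSum]
    push_cast
    refine Finset.sum_le_sum fun s hs => ?_
    obtain ⟨h1, h2⟩ := hS s hs
    rw [abs_le] at h1 h2
    simp only [Prod.le_def] at hp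
    push_cast at hp
    have hle : ((m : ℤ), (m : ℤ)) ≤ p + s := by
      simp only [Prod.le_def, Prod.fst_add, Prod.snd_add]
      omega
    have h0 : 0 ≤ p + s := le_trans (by simp [Prod.le_def]) hle
    rw [if_pos h0]
    exact ih _ hle

/-- A block is a free walk of length `m` losing at most `r` in each coordinate, then `r` diagonal
words. It ends at or above `p`, so by monotonicity all continuations from `p` remain available. -/
theorem freeSum_block_le {l : ℕ} (hS : SmallSteps S) (hl : HasDiagonalWord S l) (m r n : ℕ)
    {p : ℤ × ℤ} (hm : ((m : ℤ), (m : ℤ)) ≤ p) (hr : ((r : ℤ), (r : ℤ)) ≤ p) :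
    freeSum S (fun q => if -((r : ℤ), (r : ℤ)) ≤ q then 1 else 0) m 0 * walksFrom S n p ≤
      walksFrom S (n + (l * r + m)) p := by
  rw [← add_assoc]
  refine le_trans ?_ (freeSum_le_walksFrom hS (n + l * r) m p hm)
  rw [← freeSum_add_right _ p m 0, mul_comm, ← freeSum_const_mul, zero_add]
  refine freeSum_mono (fun q => ?_) m p
  split_ifs with h1 h2 h2
  · have h3 : p ≤ q + ((r : ℤ), (r : ℤ)) := by
      rw [neg_le_iff_add_nonneg, sub_add_eq_add_sub, sub_nonneg] at h1
      exact h1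
    rw [mul_one]
    exact_mod_cast (walksFrom_mono n h3).trans (hl.iterate r n h2)
  -- Since `(r, r) ≤ p`, an end point `q ≥ p - (r, r)` is in the quarter plane.
  · refine absurd ?_ h2
    simp only [Prod.le_def, Prod.fst_neg, Prod.snd_neg, Prod.fst_sub, Prod.snd_sub, Prod.fst_zero,
      Prod.snd_zero] at *
    omega
  · simp
  · simp

theorem freeSum_block_pow_le {l : ℕ} (hS : SmallSteps S) (hl : HasDiagonalWord S l) {m r : ℕ}
    {p : ℤ × ℤ} (hm : ((m : ℤ), (m : ℤ)) ≤ p) (hr : ((r : ℤ), (r : ℤ)) ≤ p)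
    {b : ℝ} (hb0 : 0 ≤ b)
    (hb : b ≤ freeSum S (fun q => if -((r : ℤ), (r : ℤ)) ≤ q then 1 else 0) m 0) (k : ℕ) :
    b ^ k ≤ walksFrom S (k * (l * r + m)) p := by
  induction k with
  | zero => simp [walksFrom]
  | succ k ih =>
    rw [pow_succ', Nat.succ_mul]
    exact (mul_le_mul hb ih (by positivity) (hb0.trans hb)).trans
      (freeSum_block_le hS hl m r _ hm hr)

/-! ### Weighted steps -/

/-- The steps `(s₁, s₂)` of `S`, weighted by `y ^ s₂`, have total weight `β`, and mean
displacement `(0, d)`. -/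
structure IsBalanced (S : Finset (ℤ × ℤ)) (y d β : ℝ) : Prop where
  small : SmallSteps S
  one_le : 1 ≤ y
  pos : 0 < β
  drift_nonneg : 0 ≤ d
  critical : y = 1 ∨ d = 0
  sum_weight : ∑ s ∈ S, y ^ s.2 = β
  sum_fst : ∑ s ∈ S, y ^ s.2 * s.1 = 0
  sum_snd : ∑ s ∈ S, y ^ s.2 * s.2 = β * d

namespace IsBalanced

variable {y d β : ℝ}

theorem walksFrom_le (h : IsBalanced S y d β) (n : ℕ) :
    ∀ {p : ℤ × ℤ}, 0 ≤ p → (walksFrom S n p : ℝ) ≤ y ^ p.2 * β ^ n := by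
  have hy : 0 < y := one_pos.trans_le h.one_le
  induction n with
  | zero =>
    intro p hp
    simpa [walksFrom] using one_le_zpow₀ h.one_le hp.2
  | succ n ih =>
    intro p hp
    have hβ := h.pos
    rw [walksFrom, Nat.cast_sum]
    calc ∑ s ∈ S, ((if 0 ≤ p + s then walksFrom S n (p + s) else 0 : ℕ) : ℝ)
        ≤ ∑ s ∈ S, y ^ p.2 * β ^ n * y ^ s.2 := by
          refine Finset.sum_le_sum fun s _ => ?_
          split_ifs with hs
          · refine (ih hs).trans_eq ?_
            rw [Prod.snd_add, zpow_add₀ hy.ne']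
            ring
          · simp only [Nat.cast_zero]
            positivity
      _ = y ^ p.2 * β ^ (n + 1) := by
          rw [← Finset.mul_sum, h.sum_weight]
          ring

theorem sum_sq_le (h : IsBalanced S y d β) :
    ∑ s ∈ S, y ^ s.2 * ((s.1 : ℝ) ^ 2 + (s.2 : ℝ) ^ 2) ≤ 2 * β := by
  have hy : 0 < y := one_pos.trans_le h.one_le
  rw [← h.sum_weight, Finset.mul_sum]
  refine Finset.sum_le_sum fun s hs => ?_
  have h1 : (s.1 : ℝ) ^ 2 ≤ 1 := by
    exact_mod_cast (sq_le_one_iff_abs_le_one _).2 (h.small s hs).1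
  have h2 : (s.2 : ℝ) ^ 2 ≤ 1 := by
    exact_mod_cast (sq_le_one_iff_abs_le_one _).2 (h.small s hs).2
  rw [mul_comm 2]
  gcongr
  linarith

/-- A lower bound for the weighted second moments. -/
theorem le_freeSum_sq (h : IsBalanced S y d β) (A e : ℝ) (m : ℕ) :
    ∀ p : ℤ × ℤ,
      β ^ m * y ^ p.2 * (A - 2 * m - ((p.1 : ℝ) ^ 2 + (p.2 + m * d - e) ^ 2)) ≤
        freeSum S (fun q => y ^ q.2 * (A - ((q.1 : ℝ) ^ 2 + (q.2 - e) ^ 2))) m p := by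
  have hy : 0 < y := one_pos.trans_le h.one_le
  have hβ := h.pos
  induction m with
  | zero => intro p; simp [freeSum]
  | succ m ih =>
    intro p
    rw [freeSum]
    refine le_trans ?_ (Finset.sum_le_sum fun s _ => ih (p + s))
    set a : ℝ := Int.cast p.1
    set b : ℝ := p.2 + m * d - e with hb
    have hsum : ∑ s ∈ S, β ^ m * y ^ (p + s).2 *
          (A - 2 * m - ((((p + s).1 : ℤ) : ℝ) ^ 2 + (((p + s).2 : ℤ) + m * d - e) ^ 2)) =
        β ^ m * y ^ p.2 * ((A - 2 * m - (a ^ 2 + b ^ 2)) * ∑ s ∈ S, y ^ s.2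
          - 2 * a * ∑ s ∈ S, y ^ s.2 * s.1 - 2 * b * ∑ s ∈ S, y ^ s.2 * s.2
          - ∑ s ∈ S, y ^ s.2 * ((s.1 : ℝ) ^ 2 + (s.2 : ℝ) ^ 2)) := by
      simp only [Finset.mul_sum, ← Finset.sum_sub_distrib]
      refine Finset.sum_congr rfl fun s _ => ?_
      rw [Prod.snd_add, Prod.fst_add, zpow_add₀ hy.ne']
      push_cast
      ring
    rw [hsum, h.sum_weight, h.sum_fst, h.sum_snd, pow_succ]
    -- One step shifts the mean by `d`; as steps are small, it adds at most 2 to the mean squared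
    -- distance.
    have key : β * (A - 2 * (m + 1 : ℕ) - (a ^ 2 + (p.2 + (m + 1 : ℕ) * d - e) ^ 2)) ≤
        (A - 2 * m - (a ^ 2 + b ^ 2)) * β - 2 * a * 0 - 2 * b * (β * d)
          - ∑ s ∈ S, y ^ s.2 * ((s.1 : ℝ) ^ 2 + (s.2 : ℝ) ^ 2) := by
      have h1 := h.sum_sq_le
      have h2 : 0 ≤ β * d ^ 2 := by positivity
      have h3 : (p.2 + (m + 1 : ℕ) * d - e : ℝ) = b + d := by push_cast; ring
      rw [h3]
      push_cast
      nlinarith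
    calc β ^ m * β * y ^ p.2 * (A - 2 * (m + 1 : ℕ) - (a ^ 2 + (p.2 + (m + 1 : ℕ) * d - e) ^ 2))
        = β ^ m * y ^ p.2 *
          (β * (A - 2 * (m + 1 : ℕ) - (a ^ 2 + (p.2 + (m + 1 : ℕ) * d - e) ^ 2))) := by ring
      _ ≤ _ := by gcongr

/-- Chebyshev's inequality for the number of walks of length `m ^ 2` whose end point is at least
`(-2m, -2m)`. -/
theorem le_freeSum_indicator (h : IsBalanced S y d β) {m : ℕ} (hm : 0 < m) :
    β ^ m ^ 2 / (2 * y ^ (2 * m)) ≤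
      freeSum S (fun q => if -(((2 * m : ℕ) : ℤ), ((2 * m : ℕ) : ℤ)) ≤ q then 1 else 0)
        (m ^ 2) 0 := by
  have hy : 0 < y := one_pos.trans_le h.one_le
  have hm' : (0 : ℝ) < m := by exact_mod_cast hm
  have h1 := h.le_freeSum_sq (4 * (m : ℝ) ^ 2) ((m : ℝ) ^ 2 * d) (m ^ 2) 0
  -- With `c`, the weighted paraboloid is at most 1 on the disc of radius `2m` about the mean `(0,
  -- m² d)` and nonpositive outside, hence bounded by the indicator.
  set c : ℝ := (y ^ (2 * m) * (4 * (m : ℝ) ^ 2))⁻¹ with hc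
  have hc0 : 0 < c := by positivity
  have h2 := mul_le_mul_of_nonneg_left h1 hc0.le
  rw [← freeSum_const_mul] at h2
  have h3 : c * (β ^ m ^ 2 * y ^ (0 : ℤ × ℤ).2 * (4 * (m : ℝ) ^ 2 - 2 * ((m ^ 2 : ℕ) : ℝ) -
      ((((0 : ℤ × ℤ).1 : ℤ) : ℝ) ^ 2 + (((0 : ℤ × ℤ).2 : ℤ) + ((m ^ 2 : ℕ) : ℝ) * d -
        (m : ℝ) ^ 2 * d) ^ 2))) = β ^ m ^ 2 / (2 * y ^ (2 * m)) := by
    rw [hc]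
    push_cast
    simp only [Prod.fst_zero, Prod.snd_zero, Int.cast_zero, zpow_zero]
    field_simp
    ring
  rw [h3] at h2
  refine h2.trans (freeSum_mono (fun q => ?_) _ _)
  by_cases hq : (q.1 : ℝ) ^ 2 + (q.2 - (m : ℝ) ^ 2 * d) ^ 2 < 4 * (m : ℝ) ^ 2
  · have hx : |(q.1 : ℝ)| < 2 * m :=
      abs_lt_of_sq_lt_sq (by nlinarith [sq_nonneg (q.2 - (m : ℝ) ^ 2 * d)]) (by positivity)
    have hz : |q.2 - (m : ℝ) ^ 2 * d| < 2 * m :=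
      abs_lt_of_sq_lt_sq (by nlinarith [sq_nonneg (q.1 : ℝ)]) (by positivity)
    rw [abs_lt] at hx hz
    have hd : 0 ≤ (m : ℝ) ^ 2 * d := mul_nonneg (by positivity) h.drift_nonneg
    have hle : -(((2 * m : ℕ) : ℤ), ((2 * m : ℕ) : ℤ)) ≤ q := by
      constructor
      · have : (-(2 * m : ℝ)) ≤ q.1 := hx.1.le
        simpa using (by exact_mod_cast this : -(2 * m : ℤ) ≤ q.1)
      · have : (-(2 * m : ℝ)) ≤ q.2 := by linarith
        simpa using (by exact_mod_cast this : -(2 * m : ℤ) ≤ q.2)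
    rw [if_pos hle]
    -- This is where `y = 1 ∨ d = 0` matters: otherwise `y ^ q.2` could be of order `y ^ (m² d)`.
    have hw : y ^ q.2 ≤ y ^ (2 * m) := by
      rcases h.critical with h1 | h1
      · simp [h1]
      · rw [h1] at hz
        have : (q.2 : ℝ) ≤ (2 * m : ℝ) := by linarith
        rw [← zpow_natCast]
        exact zpow_le_zpow_right₀ h.one_le (by push_cast; exact_mod_cast this)
    calc c * (y ^ q.2 * (4 * (m : ℝ) ^ 2 - ((q.1 : ℝ) ^ 2 + (q.2 - (m : ℝ) ^ 2 * d) ^ 2)))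
        ≤ c * (y ^ (2 * m) * (4 * (m : ℝ) ^ 2)) := by
          gcongr
          have := sq_nonneg (q.1 : ℝ)
          have := sq_nonneg (q.2 - (m : ℝ) ^ 2 * d)
          linarith
      _ = 1 := inv_mul_cancel₀ (by positivity)
  · have : c * (y ^ q.2 * (4 * (m : ℝ) ^ 2 - ((q.1 : ℝ) ^ 2 + (q.2 - (m : ℝ) ^ 2 * d) ^ 2))) ≤ 0 :=
      mul_nonpos_of_nonneg_of_nonpos hc0.le
        (mul_nonpos_of_nonneg_of_nonpos (by positivity) (by linarith))
    refine this.trans ?_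
    split_ifs <;> norm_num

end IsBalanced

/-! ### The growth rate -/

theorem nonpos_of_forall_nat_mul_le {a c : ℝ} (h : ∀ k : ℕ, 0 < k → k * a ≤ c) : a ≤ 0 := by
  by_contra! ha
  obtain ⟨k, hk⟩ := exists_nat_gt (c / a)
  rw [div_lt_iff₀ ha] at hk
  have := h (k + 1) k.succ_pos
  push_cast at this
  linarith

theorem walksFrom_pos {a : ℤ × ℤ} (ha : a ∈ S) (ha0 : 0 ≤ a) (n : ℕ) :
    ∀ {p : ℤ × ℤ}, 0 ≤ p → 0 < walksFrom S n p := by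
  induction n with
  | zero => intros; simp [walksFrom]
  | succ n ih =>
    intro p hp
    exact (ih (add_nonneg hp ha0)).trans_le (walksFrom_add_step_le ha (add_nonneg hp ha0) n)

theorem log_le_of_pow_le {l : ℕ} (hl : HasDiagonalWord S l) {lam b : ℝ} (hb : 0 < b) {L D : ℕ}
    (hlam : ∀ n : ℕ, Real.log (walksFrom S n 0) ≤ lam * n)
    (h : ∀ k : ℕ, b ^ k ≤ walksFrom S (k * L) ((D : ℤ), (D : ℤ))) :
    Real.log b ≤ lam * L := by
  rw [← sub_nonpos]
  refine nonpos_of_forall_nat_mul_le (c := lam * (l * D)) fun k _ => ?_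
  have h1 : (walksFrom S (k * L) ((D : ℤ), (D : ℤ)) : ℝ) ≤ walksFrom S (k * L + l * D) 0 := by
    exact_mod_cast by simpa using hl.iterate D (k * L) (le_refl (0 : ℤ × ℤ))
  have h2 := Real.log_le_log (by positivity) ((h k).trans h1)
  have h3 := hlam (k * L + l * D)
  rw [Real.log_pow] at h2
  push_cast at h3
  linarith

namespace IsBalanced

variable {y d β : ℝ}

/-- Blocks of length `m² + 2lm` give `m² log β - log 2 - 2m log y ≤ lam (m² + 2lm)`. Dividing by `m`
leaves a bound on `m (log β - lam)` independent of `m`. -/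
theorem log_le_of_forall_log_le (h : IsBalanced S y d β) {l : ℕ} (hl : HasDiagonalWord S l)
    {lam : ℝ} (hlam : ∀ n : ℕ, Real.log (walksFrom S n 0) ≤ lam * n) :
    Real.log β ≤ lam := by
  have hy : 0 < y := one_pos.trans_le h.one_le
  have hβ := h.pos
  rw [← sub_nonpos]
  refine nonpos_of_forall_nat_mul_le (c := Real.log 2 + 2 * Real.log y + 2 * l * lam)
    fun m hm => ?_
  have hD1 : ((m ^ 2 : ℕ) : ℤ) ≤ ((m ^ 2 + 2 * m : ℕ) : ℤ) := by push_cast; omega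
  have hD2 : ((2 * m : ℕ) : ℤ) ≤ ((m ^ 2 + 2 * m : ℕ) : ℤ) := by
    push_cast; linarith [sq_nonneg (m : ℤ)]
  have h1 := log_le_of_pow_le hl (by positivity) hlam
    (freeSum_block_pow_le h.small hl (Prod.mk_le_mk.2 ⟨hD1, hD1⟩) (Prod.mk_le_mk.2 ⟨hD2, hD2⟩)
      (by positivity) (h.le_freeSum_indicator hm))
  rw [Real.log_div (by positivity) (by positivity), Real.log_mul (by positivity) (by positivity),
    Real.log_pow, Real.log_pow] at h1
  push_cast at h1
  have hm1 : (1 : ℝ) ≤ m := by exact_mod_cast hm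
  have h2 : Real.log 2 ≤ m * Real.log 2 :=
    le_mul_of_one_le_left (Real.log_nonneg one_le_two) hm1
  refine le_of_mul_le_mul_left (a := (m : ℝ)) ?_ (by linarith)
  linarith

theorem tendsto_log (h : IsBalanced S y d β) {l : ℕ} (hl : HasDiagonalWord S l)
    (hpos : ∀ n, 0 < walksFrom S n 0) :
    Tendsto (fun n : ℕ => Real.log (walksFrom S n 0) / n) atTop (𝓝 (Real.log β)) := by
  have hpos' (n : ℕ) : (0 : ℝ) < walksFrom S n 0 := by exact_mod_cast hpos n
  have hub (n : ℕ) : Real.log (walksFrom S n 0) ≤ n * Real.log β := by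
    rw [← Real.log_pow]
    refine Real.log_le_log (hpos' n) ?_
    simpa using h.walksFrom_le n (le_refl (0 : ℤ × ℤ))
  -- The maximum with 0 covers `n = 0`, where the quotient is 0 by convention.
  have hub' (n : ℕ) : Real.log (walksFrom S n 0) / n ≤ max (Real.log β) 0 := by
    rcases n.eq_zero_or_pos with rfl | hn
    · simp
    · refine le_max_of_le_left ((div_le_iff₀ (by exact_mod_cast hn)).2 ?_)
      rw [mul_comm]
      exact hub n
  have hsub : Subadditive fun n : ℕ => -Real.log (walksFrom S n 0) := by
    intro m n
    have h1 : (walksFrom S m 0 * walksFrom S n 0 : ℝ) ≤ walksFrom S (m + n) 0 := by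
      exact_mod_cast walksFrom_mul_le m n (le_refl (0 : ℤ × ℤ))
    have h2 := Real.log_le_log (mul_pos (hpos' m) (hpos' n)) h1
    rw [Real.log_mul (hpos' m).ne' (hpos' n).ne'] at h2
    linarith
  have hbdd : BddBelow (Set.range fun n : ℕ => -Real.log (walksFrom S n 0) / n) := by
    refine ⟨-max (Real.log β) 0, ?_⟩
    rintro _ ⟨n, rfl⟩
    dsimp only
    rw [neg_div]
    exact neg_le_neg (hub' n)
  have hlim : Tendsto (fun n : ℕ => Real.log (walksFrom S n 0) / n) atTop (𝓝 (-hsub.lim)) := by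
    simpa [neg_div] using (hsub.tendsto_lim hbdd).neg
  -- The Fekete limit is also a supremum, so it bounds the rate at every `n`.
  have hlower : Real.log β ≤ -hsub.lim := by
    refine h.log_le_of_forall_log_le hl fun n => ?_
    rcases n.eq_zero_or_pos with rfl | hn
    · simp [walksFrom]
    · have h1 := hsub.lim_le_div hbdd hn.ne'
      rw [le_div_iff₀ (by exact_mod_cast hn)] at h1
      linarith
  have hupper : -hsub.lim ≤ Real.log β := by
    refine le_of_tendsto hlim ((eventually_gt_atTop 0).mono fun n hn => ?_)
    rw [div_le_iff₀ (by exact_mod_cast hn), mul_comm]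
    exact hub n
  rwa [le_antisymm hlower hupper]

theorem exponential_growth (h : IsBalanced S y d β) {l : ℕ} (hl : HasDiagonalWord S l)
    {a : ℤ × ℤ} (ha : a ∈ S) (ha0 : 0 ≤ a) :
    IsOfExponentialOrder (fun n : ℕ => (walkCount S n : ℝ)) β ∧
      Tendsto (fun n : ℕ => 1 / (n : ℝ) * Real.log (walkCount S n : ℝ)) atTop
        (𝓝 (Real.log β)) := by
  have hpos (n : ℕ) : 0 < walksFrom S n 0 := walksFrom_pos ha ha0 n le_rfl
  have hlim := h.tendsto_log hl hpos
  simp only [IsOfExponentialOrder, walkCount_eq_walksFrom, Nat.abs_cast]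
  refine ⟨Tendsto.limsup_eq ?_, by simpa only [one_div_mul_eq_div] using hlim⟩
  have h1 := (Real.continuous_exp.tendsto _).comp hlim
  rw [Real.exp_log h.pos] at h1
  refine (continuous_coe_real_ereal.tendsto β).comp (h1.congr fun n => ?_)
  have : (0 : ℝ) < walksFrom S n 0 := by exact_mod_cast hpos n
  rw [Function.comp_apply, Real.rpow_def_of_pos this, mul_one_div]

end IsBalanced

/-! ### The 23 models -/

/-- The alternatives in `hw` yield the diagonal words NE, N E, N N SE and E E NW. -/
theorem exponential_growth_of_weight (y d : ℝ) {β : ℝ} (hS : SmallSteps S) (hβ : 0 < β)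
    (hy : 1 ≤ y) (hd : 0 ≤ d) (hyd : y = 1 ∨ d = 0) (h0 : ∑ s ∈ S, y ^ s.2 = β)
    (h1 : ∑ s ∈ S, y ^ s.2 * s.1 = 0) (h2 : ∑ s ∈ S, y ^ s.2 * s.2 = β * d)
    (hw : NE ∈ S ∨ (N ∈ S ∧ E ∈ S) ∨ (N ∈ S ∧ SE ∈ S) ∨ (E ∈ S ∧ NW ∈ S)) :
    IsOfExponentialOrder (fun n : ℕ => (walkCount S n : ℝ)) β ∧
      Tendsto (fun n : ℕ => 1 / (n : ℝ) * Real.log (walkCount S n : ℝ)) atTop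
        (𝓝 (Real.log β)) := by
  have h : IsBalanced S y d β := ⟨hS, hy, hβ, hd, hyd, h0, h1, h2⟩
  rcases hw with ha | ⟨ha, hb⟩ | ⟨ha, hb⟩ | ⟨ha, hb⟩
  · exact h.exponential_growth (hasDiagonalWord_one ha rfl) ha (by decide)
  · exact h.exponential_growth (hasDiagonalWord_two ha hb (by decide) (by decide)) ha (by decide)
  · exact h.exponential_growth (hasDiagonalWord_three ha hb (by decide) (by decide)) ha (by decide)
  · exact h.exponential_growth (hasDiagonalWord_three ha hb (by decide) (by decide)) ha (by decide)

/-- The model of index `i` has exponential growth factor `growthFactor i`. -/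
def HasGrowth (i : ℕ) : Prop :=
  IsOfExponentialOrder (fun n : ℕ => (walkCount (stepSet i) n : ℝ)) (growthFactor i) ∧
    Tendsto (fun n : ℕ => 1 / (n : ℝ) * Real.log (walkCount (stepSet i) n : ℝ)) atTop
      (𝓝 (Real.log (growthFactor i)))

theorem smallSteps_stepSet {i : ℕ} (hi : 1 ≤ i ∧ i ≤ 23) : SmallSteps (stepSet i) := by
  obtain ⟨h1, h2⟩ := hi
  unfold SmallSteps
  interval_cases i <;> decide

theorem hasGrowth_of_weight_one {i : ℕ} (hi : i ∈ Finset.Icc 1 10 ∪ Finset.Icc 17 23) :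
    HasGrowth i := by
  have hi' : 1 ≤ i ∧ i ≤ 23 := by
    simp only [Finset.mem_union, Finset.mem_Icc] at hi
    omega
  have hw : NE ∈ stepSet i ∨ (N ∈ stepSet i ∧ E ∈ stepSet i) ∨
      (N ∈ stepSet i ∧ SE ∈ stepSet i) ∨ (E ∈ stepSet i ∧ NW ∈ stepSet i) := by
    revert i
    decide
  have hx : ∑ s ∈ stepSet i, s.1 = 0 := by
    clear hi' hw
    revert i
    decide
  have hd : 0 ≤ ∑ s ∈ stepSet i, s.2 := by
    clear hi' hw hx
    revert i
    decide
  have hcard : ((stepSet i).card : ℝ) = growthFactor i := by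
    clear hx hd hw
    obtain ⟨h1, h2⟩ := hi'
    interval_cases i <;> first
      | (exfalso; revert hi; decide)
      | (simp only [growthFactor]; norm_cast)
  have hne : 0 < (stepSet i).card := by
    refine Finset.card_pos.2 ?_
    rcases hw with h | ⟨h, -⟩ | ⟨h, -⟩ | ⟨h, -⟩ <;> exact ⟨_, h⟩
  have hpos : 0 < growthFactor i := by
    rw [← hcard]
    exact_mod_cast hne
  refine exponential_growth_of_weight 1 ((∑ s ∈ stepSet i, (s.2 : ℝ)) / growthFactor i)
    (smallSteps_stepSet hi') hpos le_rfl ?_ (Or.inl rfl) ?_ ?_ ?_ hw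
  · refine div_nonneg ?_ hpos.le
    exact_mod_cast hd
  · simpa using hcard
  · simp only [one_zpow, one_mul]
    exact_mod_cast hx
  · simp only [one_zpow, one_mul]
    field_simp

/-- The weight that cancels the vertical drift in the models of index `11, …, 16`. -/
noncomputable def driftWeight : ℕ → ℝ
  | 11 => √3
  | 12 => √3
  | 13 => √6 / 2
  | 14 => √6 / 2
  | 15 => √2
  | 16 => √2
  | _ => 1

theorem hasGrowth_of_weight_sqrt {i : ℕ} (hi : 11 ≤ i ∧ i ≤ 16) : HasGrowth i := by
  have hw : NE ∈ stepSet i ∨ (N ∈ stepSet i ∧ E ∈ stepSet i) ∨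
      (N ∈ stepSet i ∧ SE ∈ stepSet i) ∨ (E ∈ stepSet i ∧ NW ∈ stepSet i) := by
    obtain ⟨h1, h2⟩ := hi
    interval_cases i <;> decide
  have hS : SmallSteps (stepSet i) := smallSteps_stepSet (by omega)
  have s2 : √2 ^ 2 = 2 := Real.sq_sqrt (by norm_num)
  have s3 : √3 ^ 2 = 3 := Real.sq_sqrt (by norm_num)
  have s6 : √6 ^ 2 = 6 := Real.sq_sqrt (by norm_num)
  have p2 : 0 < √2 := by positivity
  have p3 : 0 < √3 := by positivity
  have p6 : 0 < √6 := by positivity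
  -- The weight is the square root of the ratio of downward to upward steps, the minimiser of `∑ y ^
  -- s.2`, so the weighted vertical drift is zero.
  refine exponential_growth_of_weight (driftWeight i) 0 hS ?_ ?_ le_rfl (Or.inr rfl) ?_ ?_ ?_ hw
  · obtain ⟨h1, h2⟩ := hi
    interval_cases i <;> simp only [growthFactor] <;> positivity
  · obtain ⟨h1, h2⟩ := hi
    interval_cases i <;> simp only [driftWeight] <;> nlinarith
  all_goals
    obtain ⟨h1, h2⟩ := hi
    interval_cases i <;>
      simp [driftWeight, growthFactor, stepSet, N, S, E, W, NE, NW, SE, SW] <;>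
      field_simp <;> nlinarith

end QuarterPlane

theorem mainTheorem1 (i : ℕ) (hi : 1 ≤ i ∧ i ≤ 23) :
    QuarterPlane.IsOfExponentialOrder
        (fun n : ℕ => (QuarterPlane.walkCount (QuarterPlane.stepSet i) n : ℝ))
        (QuarterPlane.growthFactor i) ∧
      Tendsto
        (fun n : ℕ =>
          1 / (n : ℝ) * Real.log (QuarterPlane.walkCount (QuarterPlane.stepSet i) n : ℝ))
        atTop (𝓝 (Real.log (QuarterPlane.growthFactor i))) := by
  by_cases h : 11 ≤ i ∧ i ≤ 16
  · exact QuarterPlane.hasGrowth_of_weight_sqrt h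
  · refine QuarterPlane.hasGrowth_of_weight_one ?_
    simp only [Finset.mem_union, Finset.mem_Icc]
    omega
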